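/- Let $n$ be a positive integer, and write $M\ge 0$ if the matrix $M\in M_n(\mathbb C)$ is positive semidefinite. Let $\mathcal G$ be the class of $M_n(\mathbb C)$-valued rational functions of the form $$f(z)=Az+B-\sum_{j=1}^d\frac{C_j}{z+\lambda_j},$$ where $d\ge 0$, the $\lambda_j>0$ are pairwise distinct real numbers, $A,B,C_j\ge 0$, and $f(0)=B-\sum_j C_j/\lambda_j\ge 0$. The partial McMillan degree of such an $f$ is $\delta(f)=\sum_{j=1}^d \operatorname{rank} C_j$ (it does not depend on the representation of $f$). For an $M_n(\mathbb C)$-valued rational function $R$, a rational function $G=[R]^{-1}$ is called the partial inverse of $R$ if there is an orthogonal projection $P$ of $\mathbb C^n$ with $PR=RP=R$, $PG=GP=G$ and $RG=GR=P$; that is, $R$ maps $\operatorname{ran}P$ to itself and vanishes on $\ker P$, while $G$ is the inverse of $R$ on $\operatorname{ran}P$ and vanishes on $\ker P$. (Then $P$ and $G$ are determined by $R$; if $R(z)=-\sum_j C_j/(z+\lambda_j)$ with $\lambda_j>0$ distinct and $C_j\ge 0$, then $P$ is the orthogonal projection onto the range of $\sum_j C_j$.) Theorem. Let $f\in\mathcal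 G$. Then the partial inverse in $$f_1(z)=-\Big[\frac{f(z)-f(0)-f'(0)z}{z^2}\Big]^{-1}$$ exists and is unique, the rational function $f_1$ belongs to $\mathcal G$, and $\delta(f_1)<\delta(f)$ if $\delta(f)>0$, while $f_1=0$ if $\delta(f)=0$. Moreover, iterating this step terminates: there are $N\le\delta(f)$ and $F_0=f,F_1,\dots,F_N\in\mathcal G$ such that, for $k<N$, $F_{k+1}$ is obtained from $F_k$ as $f_1$ is from $f$, with $\delta(F_{k+1})<\delta(F_k)$, and $\delta(F_N)=0$. The matrices $A_k=F_k(0)$ and $B_k=F_k'(0)$, $0\le k\le N$, are positive semidefinite, and with partial inverses written as fractions $$f(z)=A_0+B_0z-\cfrac{z^2}{A_1+B_1z-\cfrac{z^2}{\ddots-\cfrac{z^2}{A_N+B_Nz}}},$$ $$z f(1/z)=A_0z+B_0-\cfrac{1}{A_1z+B_1-\cfrac{1}{\ddots-\cfrac{1}{A_Nz+B_N}}}.$$ -/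

import Mathlib

open Matrix Filter Topology
open scoped ComplexOrder

namespace RationalG

/-- Rational functions of one complex variable `z` with values in `M_n(ℂ)`: matrices whose entries
are scalar rational functions. The variable `z` is `RatFunc.X`. -/
abbrev RatMat (n : ℕ) : Type := Matrix (Fin n) (Fin n) (RatFunc ℂ)

/-- A complex matrix seen as a constant matrix valued rational function. -/
noncomputable def const {n : ℕ} (M : Matrix (Fin n) (Fin n) ℂ) : RatMat n :=
  M.map RatFunc.C

/-- The value `f(z)` of a matrix valued rational function at a point `z` that is not a pole. -/
noncomputable def value {n : ℕ} (f : RatMat n) (z : ℂ) : Matrix (Fin n) (Fin n) ℂ :=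
  Matrix.of fun i j => (f i j).eval (RingHom.id ℂ) z

/-- The derivative `f'(z)` at a point `z` that is not a pole. -/
noncomputable def derivValue {n : ℕ} (f : RatMat n) (z : ℂ) : Matrix (Fin n) (Fin n) ℂ :=
  Matrix.of fun i j => deriv (fun w : ℂ => (f i j).eval (RingHom.id ℂ) w) z

/-- The affine function `A z + B`. -/
noncomputable def affine {n : ℕ} (A B : Matrix (Fin n) (Fin n) ℂ) : RatMat n :=
  (RatFunc.X : RatFunc ℂ) • const A + const B

/-- The representation `f(z) = A z + B - ∑ j, C j / (z + lam j)` of an element of the class `𝒢`: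
the points `lam j` are positive and pairwise distinct, the matrices `A`, `B`, `C j` are
non-negative, and so is `f(0) = B - ∑ j, C j / lam j`. -/
structure IsRep {n d : ℕ} (f : RatMat n) (A B : Matrix (Fin n) (Fin n) ℂ) (lam : Fin d → ℝ)
    (C : Fin d → Matrix (Fin n) (Fin n) ℂ) : Prop where
  lam_pos : ∀ j, 0 < lam j
  lam_injective : Function.Injective lam
  A_nonneg : A.PosSemidef
  B_nonneg : B.PosSemidef
  C_nonneg : ∀ j, (C j).PosSemidef
  zero_nonneg : (B - ∑ j, ((lam j : ℂ)⁻¹) • C j).PosSemidef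
  eq : f = affine A B - ∑ j, (RatFunc.X + RatFunc.C (lam j : ℂ))⁻¹ • const (C j)

/-- The class `𝒢` of `M_n(ℂ)`-valued rational functions. -/
def classG (n : ℕ) : Set (RatMat n) :=
  {f | ∃ (d : ℕ) (A B : Matrix (Fin n) (Fin n) ℂ) (lam : Fin d → ℝ)
    (C : Fin d → Matrix (Fin n) (Fin n) ℂ), IsRep f A B lam C}

/-- The number `∑ j, rank (C j)` is computed from some representation of `f`. -/
def IsPartialDegree {n : ℕ} (f : RatMat n) (k : ℕ) : Prop :=
  ∃ (d : ℕ) (A B : Matrix (Fin n) (Fin n) ℂ) (lam : Fin d → ℝ)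
    (C : Fin d → Matrix (Fin n) (Fin n) ℂ), IsRep f A B lam C ∧ k = ∑ j, (C j).rank

/-- The partial McMillan degree `δ(f) = ∑ j, rank (C j)` of an element `f` of the class `𝒢`. It
does not depend on the representation of `f`, see `IsRep.delta_eq`. -/
noncomputable def delta {n : ℕ} (f : RatMat n) : ℕ :=
  sInf {k | IsPartialDegree f k}

/-- `G` is the partial inverse `[R]⁻¹` of `R`: for an orthogonal projection `P` of `ℂⁿ`, the
values of `R` map `ran P` to itself and vanish on `ker P`, and `G` is the inverse of `R` on `ran P`
and vanishes on `ker P`. Both `P` and `G` are determined by `R`; for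
`R(z) = -∑ j, C j / (z + lam j)` with `lam j > 0` and `C j` non-negative, `P` is the orthogonal
projection onto the range of `∑ j, C j`. -/
def IsPartialInverse {n : ℕ} (R G : RatMat n) : Prop :=
  ∃ P : Matrix (Fin n) (Fin n) ℂ, IsStarProjection P ∧
    const P * R = R ∧ R * const P = R ∧
    const P * G = G ∧ G * const P = G ∧
    R * G = const P ∧ G * R = const P

/-- The quotient `(f(z) - f(0) - f'(0) z) / z²`. -/
noncomputable def secondQuotient {n : ℕ} (f : RatMat n) : RatMat n :=
  ((RatFunc.X : RatFunc ℂ) ^ 2)⁻¹ • (f - const (value f 0) - (RatFunc.X : RatFunc ℂ) • const (derivValue f 0))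

/-- `f₁ = -[(f(z) - f(0) - f'(0) z) / z²]⁻¹`, with the partial inverse. -/
def IsReduction {n : ℕ} (f f₁ : RatMat n) : Prop :=
  ∃ G : RatMat n, IsPartialInverse (secondQuotient f) G ∧ f₁ = -G

/-- The terminating fraction
`f(z) = A 0 + B 0 z - z² [A 1 + B 1 z - z² [ ⋯ - z² [A N + B N z]⁻¹ ⋯ ]⁻¹]⁻¹`,
with partial inverses. -/
def IsStieltjesFraction {n : ℕ} :
    ℕ → (ℕ → Matrix (Fin n) (Fin n) ℂ) → (ℕ → Matrix (Fin n) (Fin n) ℂ) → RatMat n → Prop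
  | 0, A, B, f => f = affine (B 0) (A 0)
  | N + 1, A, B, f => ∃ g H : RatMat n,
      IsStieltjesFraction N (fun k => A (k + 1)) (fun k => B (k + 1)) g ∧ IsPartialInverse g H ∧
      f = affine (B 0) (A 0) - ((RatFunc.X : RatFunc ℂ) ^ 2) • H

/-- The terminating fraction
`f(z) = A 0 z + B 0 - [A 1 z + B 1 - [ ⋯ - [A N z + B N]⁻¹ ⋯ ]⁻¹]⁻¹`, with partial inverses. -/
def IsJFraction {n : ℕ} :
    ℕ → (ℕ → Matrix (Fin n) (Fin n) ℂ) → (ℕ → Matrix (Fin n) (Fin n) ℂ) → RatMat n → Prop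
  | 0, A, B, f => f = affine (A 0) (B 0)
  | N + 1, A, B, f => ∃ g H : RatMat n,
      IsJFraction N (fun k => A (k + 1)) (fun k => B (k + 1)) g ∧ IsPartialInverse g H ∧
      f = affine (A 0) (B 0) - H

/-- The reflection `z f(1/z)`. -/
noncomputable def reflect {n : ℕ} (f : RatMat n) : RatMat n :=
  (RatFunc.X : RatFunc ℂ) • f.map fun r => r.eval RatFunc.C (RatFunc.X : RatFunc ℂ)⁻¹

/-- The scalar rational function `r` has no pole at `z`. -/
def Regular (z : ℂ) (r : RatFunc ℂ) : Prop :=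
  Polynomial.eval₂ (RingHom.id ℂ) z r.denom ≠ 0

theorem Regular.add {z : ℂ} {r s : RatFunc ℂ} (hr : Regular z r) (hs : Regular z s) :
    Regular z (r + s) := by
  intro h
  have := Polynomial.eval₂_eq_zero_of_dvd_of_eval₂_eq_zero (RingHom.id ℂ) z
    (RatFunc.denom_add_dvd r s) h
  rw [Polynomial.eval₂_mul] at this
  exact (mul_ne_zero hr hs) this

theorem Regular.mul {z : ℂ} {r s : RatFunc ℂ} (hr : Regular z r) (hs : Regular z s) :
    Regular z (r * s) := by
  intro h
  have := Polynomial.eval₂_eq_zero_of_dvd_of_eval₂_eq_zero (RingHom.id ℂ) z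
    (RatFunc.denom_mul_dvd r s) h
  rw [Polynomial.eval₂_mul] at this
  exact (mul_ne_zero hr hs) this

theorem regular_C (z c : ℂ) : Regular z (RatFunc.C c) := by simp [Regular]

theorem regular_X (z : ℂ) : Regular z RatFunc.X := by simp [Regular]

theorem regular_inv {z c : ℂ} (h : z + c ≠ 0) :
    Regular z (RatFunc.X + RatFunc.C c)⁻¹ ∧
      RatFunc.eval (RingHom.id ℂ) z (RatFunc.X + RatFunc.C c)⁻¹ = (z + c)⁻¹ := by
  have e : (RatFunc.X + RatFunc.C c : RatFunc ℂ) =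
      algebraMap (Polynomial ℂ) (RatFunc ℂ) (Polynomial.X + Polynomial.C c) := by
    simp [RatFunc.algebraMap_X, RatFunc.algebraMap_C]
  have hne : (RatFunc.X + RatFunc.C c : RatFunc ℂ) ≠ 0 := by
    rw [e]
    exact RatFunc.algebraMap_ne_zero (Polynomial.X_add_C_ne_zero c)
  have hreg : Regular z (RatFunc.X + RatFunc.C c)⁻¹ := by
    intro h0
    have := Polynomial.eval₂_eq_zero_of_dvd_of_eval₂_eq_zero (RingHom.id ℂ) z
      (RatFunc.denom_inv_dvd hne) h0
    rw [e, RatFunc.num_algebraMap] at this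
    simp at this
    exact h this
  refine ⟨hreg, ?_⟩
  have h1 : RatFunc.eval (RingHom.id ℂ) z ((RatFunc.X + RatFunc.C c) * (RatFunc.X + RatFunc.C c)⁻¹)
      = 1 := by rw [mul_inv_cancel₀ hne, RatFunc.eval_one]
  rw [RatFunc.eval_mul _ _ ((regular_X z).add (regular_C z c)) hreg,
    RatFunc.eval_add _ _ (regular_X z) (regular_C z c)] at h1
  simp at h1
  exact eq_inv_of_mul_eq_one_right h1

/-- Away from the poles, the values of `f` are given by the formula of the representation. -/
theorem IsRep.eval_eq {n d : ℕ} {f : RatMat n} {A B : Matrix (Fin n) (Fin n) ℂ} {lam : Fin d → ℝ}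
    {C : Fin d → Matrix (Fin n) (Fin n) ℂ} (h : IsRep f A B lam C) (z : ℂ)
    (hz : ∀ j, z + lam j ≠ 0) (i k : Fin n) :
    value f z i k = z * A i k + B i k - ∑ j, (z + lam j)⁻¹ * C j i k := by
  have e : f i k = RatFunc.X * RatFunc.C (A i k) + RatFunc.C (B i k) +
      ∑ j, (RatFunc.X + RatFunc.C (lam j : ℂ))⁻¹ * RatFunc.C (-C j i k) := by
    rw [h.eq]
    simp [affine, const, Matrix.sum_apply, sub_eq_add_neg]
  have hsum : ∀ s : Finset (Fin d),
      Regular z (∑ j ∈ s, (RatFunc.X + RatFunc.C (lam j : ℂ))⁻¹ * RatFunc.C (-C j i k)) ∧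
      RatFunc.eval (RingHom.id ℂ) z
        (∑ j ∈ s, (RatFunc.X + RatFunc.C (lam j : ℂ))⁻¹ * RatFunc.C (-C j i k)) =
        ∑ j ∈ s, (z + lam j)⁻¹ * (-C j i k) := by
    classical
    intro s
    induction s using Finset.induction_on with
    | empty => simp [Regular]
    | insert a s ha ih =>
      obtain ⟨h1, h2⟩ := regular_inv (hz a)
      have h3 := h1.mul (regular_C z (-C a i k))
      rw [Finset.sum_insert ha, Finset.sum_insert ha]
      refine ⟨h3.add ih.1, ?_⟩
      rw [RatFunc.eval_add _ _ h3 ih.1, ih.2, RatFunc.eval_mul _ _ h1 (regular_C z _), h2, RatFunc.eval_C]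
      rfl
  have hX := (regular_X z).mul (regular_C z (A i k))
  change RatFunc.eval (RingHom.id ℂ) z (f i k) = _
  rw [e, RatFunc.eval_add _ _ (hX.add (regular_C z _)) (hsum Finset.univ).1, (hsum Finset.univ).2,
    RatFunc.eval_add _ _ hX (regular_C z _), RatFunc.eval_mul _ _ (regular_X z) (regular_C z _),
    RatFunc.eval_X, RatFunc.eval_C, RatFunc.eval_C]
  simp [sub_eq_add_neg]

/-- The weight at the point `a` of a representation is determined by `f`, as a residue. -/
theorem IsRep.tendsto {n d : ℕ} {f : RatMat n} {A B : Matrix (Fin n) (Fin n) ℂ} {lam : Fin d → ℝ}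
    {C : Fin d → Matrix (Fin n) (Fin n) ℂ} (h : IsRep f A B lam C) (a : ℝ) (i k : Fin n) :
    Tendsto (fun z : ℂ => (z + a) * value f z i k) (𝓝[≠] (-a : ℂ))
      (𝓝 (-∑ j, if lam j = a then C j i k else 0)) := by
  have key : Tendsto (fun z : ℂ => (z + a) * (z * A i k + B i k) -
      ∑ j, (if lam j = a then C j i k else (z + a) * ((z + lam j)⁻¹ * C j i k)))
      (𝓝[≠] (-a : ℂ)) (𝓝 (((-a : ℂ) + a) * ((-a : ℂ) * A i k + B i k) -
        ∑ j, (if lam j = a then C j i k else 0))) := by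
    refine Tendsto.sub ?_ (tendsto_finsetSum _ fun j _ => ?_)
    · exact (Continuous.tendsto (by fun_prop) _).mono_left nhdsWithin_le_nhds
    · by_cases hj : lam j = a
      · simp [hj]
      · simp only [hj, if_false]
        have hne : (-a : ℂ) + lam j ≠ 0 := by
          intro h0
          apply hj
          have : ((lam j : ℂ)) = a := by linear_combination h0
          exact_mod_cast this
        have : ContinuousAt (fun z : ℂ => (z + a) * ((z + lam j)⁻¹ * C j i k)) (-a : ℂ) := by
          fun_prop (disch := exact hne)
        have := this.tendsto
        simp only [neg_add_cancel, zero_mul] at this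
        exact this.mono_left nhdsWithin_le_nhds
  rw [neg_add_cancel, zero_mul, zero_sub] at key
  refine key.congr' ?_
  have hev : ∀ᶠ z : ℂ in 𝓝[≠] (-a : ℂ), ∀ j, z + lam j ≠ 0 := by
    rw [eventually_all]
    intro j
    by_cases hj : lam j = a
    · filter_upwards [self_mem_nhdsWithin] with z hz h0
      apply hz
      rw [Set.mem_singleton_iff]
      rw [hj] at h0
      linear_combination h0
    · have hne : (-a : ℂ) + lam j ≠ 0 := by
        intro h0
        apply hj
        have : ((lam j : ℂ)) = a := by linear_combination h0
        exact_mod_cast this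
      have hc : ContinuousAt (fun z : ℂ => z + lam j) (-a : ℂ) := by fun_prop
      exact (hc.eventually_ne hne).filter_mono nhdsWithin_le_nhds
  filter_upwards [hev] with z hz
  rw [h.eval_eq z hz, mul_sub, Finset.mul_sum]
  congr 1
  refine Finset.sum_congr rfl fun j _ => ?_
  by_cases hj : lam j = a
  · have := hz j
    rw [hj] at this
    simp only [hj, if_true]
    field_simp
  · simp [hj]

theorem IsRep.sum_rank_eq {n d : ℕ} {f : RatMat n} {A B : Matrix (Fin n) (Fin n) ℂ}
    {lam : Fin d → ℝ} {C : Fin d → Matrix (Fin n) (Fin n) ℂ} (h : IsRep f A B lam C) :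
    ∑ j, (C j).rank = ∑ᶠ a : ℝ, (Matrix.of fun i k =>
      limUnder (𝓝[≠] (-a : ℂ)) fun z : ℂ => (z + a) * value f z i k).rank := by
  classical
  have hres : ∀ a : ℝ, (Matrix.of fun i k =>
      limUnder (𝓝[≠] (-a : ℂ)) fun z : ℂ => (z + a) * value f z i k) =
      -∑ j, (if lam j = a then C j else 0) := by
    intro a
    ext i k
    rw [Matrix.of_apply, (h.tendsto a i k).limUnder_eq, Matrix.neg_apply, Matrix.sum_apply]
    congr 1
    refine Finset.sum_congr rfl fun j _ => ?_
    split_ifs <;> rfl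
  have hneg : ∀ M : Matrix (Fin n) (Fin n) ℂ, (-M).rank = M.rank := by
    intro M
    have h1 : (-M).mulVecLin = -M.mulVecLin := by
      ext; simp
    unfold Matrix.rank
    rw [h1, LinearMap.range_neg]
  simp_rw [hres, hneg]
  rw [finsum_eq_sum_of_support_subset (s := Finset.univ.image lam), Finset.sum_image]
  · refine Finset.sum_congr rfl fun j _ => ?_
    rw [Finset.sum_eq_single j]
    · simp
    · intro b _ hb
      rw [if_neg (fun e => hb (h.lam_injective e))]
    · simp
  · exact fun _ _ _ _ e => h.lam_injective e
  · intro a ha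
    by_contra hn
    apply ha
    have : ∀ j, lam j ≠ a := by
      intro j e
      apply hn
      simp only [Finset.coe_image, Finset.coe_univ, Set.image_univ]
      exact ⟨j, e⟩
    simp [this]

/-- The partial McMillan degree can be computed from any representation. -/
theorem IsRep.delta_eq {n d : ℕ} {f : RatMat n} {A B : Matrix (Fin n) (Fin n) ℂ}
    {lam : Fin d → ℝ} {C : Fin d → Matrix (Fin n) (Fin n) ℂ} (h : IsRep f A B lam C) :
    delta f = ∑ j, (C j).rank := by
  have hs : {k | IsPartialDegree f k} = {∑ j, (C j).rank} := by
    ext k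
    constructor
    · rintro ⟨d', A', B', lam', C', h', rfl⟩
      rw [Set.mem_singleton_iff, h'.sum_rank_eq, h.sum_rank_eq]
    · rintro rfl
      exact ⟨d, A, B, lam, C, h, rfl⟩
  rw [delta, hs, csInf_singleton]

end RationalG

open RationalG

/-!
Write `f ∈ 𝒢` with weights `C j` at the points `lam j`. The geometric series at `0` gives
`(f(z) - f(0) - f'(0) z) / z² = -∑ j, D j / (z + lam j)` with `D j = C j / (lam j)²`
(`IsRep.secondQuotient_eq`). Factoring each `D j` as `Wᴴ W` with `rank (D j)` rows writes this sum
as `S(z) = Wᴴ (z + diag ℓ)⁻¹ W` on a space of dimension `δ(f)` (`exists_eq_stieltjesSum`), so that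
`f₁` is the partial inverse of `S`.

In an orthonormal basis adapted to the range of `W` (`exists_adapted_basis`), `W` is a block `V`
with independent rows above a zero block, and `diag ℓ` becomes a positive definite block matrix `L`.
Hence `S` only sees the upper left block of `(z + L)⁻¹`, and this is the inverse of the Schur
complement `T(z) = z + L₁₁ - L₁₂ (z + L₂₂)⁻¹ L₂₁` (`schurComplement_mul_toBlocks₁₁`). With a right
inverse `Y` of `V` for which `Y V` is the orthogonal projection, `[S]⁻¹ = Y T Yᴴ`. After a
diagonalization of `L₂₂ > 0` this is an affine function minus a sum of simple fractions of total
rank at most the size of `L₂₂`, that is, `δ(f) - rank W`; its value at `0` is non-negative because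
the Schur complement of `L > 0` is (`exists_partialInverse_stieltjesSum`). If `W = 0` then `f` is
affine and `δ(f) = 0`; otherwise the degree drops.

Iteration yields the first fraction, since `f = f(0) + f'(0) z + z² · (second quotient)` and partial
inversion is an involution compatible with signs. The second fraction is the image of the first
under `f ↦ z f(1/z)`, which is built from a ring homomorphism on scalar rational functions.
-/

namespace RationalG

variable {α β σ τ : Type*}

/-! ### Constant matrices and spectral decomposition -/

/-- A rectangular complex matrix seen as a constant matrix of rational functions; the square case
is `RationalG.const`. -/
noncomputable def lift (M : Matrix α β ℂ) : Matrix α β (RatFunc ℂ) := M.map RatFunc.C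

theorem const_eq_lift {n : ℕ} (M : Matrix (Fin n) (Fin n) ℂ) : const M = lift M := rfl

theorem lift_injective : Function.Injective (lift : Matrix α β ℂ → _) :=
  Matrix.map_injective RatFunc.C_injective

theorem lift_mul [Fintype β] (M : Matrix α β ℂ) (N : Matrix β τ ℂ) :
    lift (M * N) = lift M * lift N := Matrix.map_mul

theorem lift_zero : lift (0 : Matrix α β ℂ) = 0 := Matrix.map_zero _ (map_zero _)

theorem lift_one [DecidableEq α] : lift (1 : Matrix α α ℂ) = 1 :=
  Matrix.map_one _ (map_zero _) (map_one _)

theorem lift_diagonal [DecidableEq α] (v : α → ℂ) :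
    lift (diagonal v) = diagonal fun a => RatFunc.C (v a) :=
  Matrix.diagonal_map (map_zero _)

theorem X_add_C_ne_zero (c : ℂ) : (RatFunc.X + RatFunc.C c : RatFunc ℂ) ≠ 0 := by
  have e : (RatFunc.X + RatFunc.C c : RatFunc ℂ) =
      algebraMap (Polynomial ℂ) (RatFunc ℂ) (Polynomial.X + Polynomial.C c) := by
    simp [RatFunc.algebraMap_X, RatFunc.algebraMap_C]
  rw [e]
  exact RatFunc.algebraMap_ne_zero (Polynomial.X_add_C_ne_zero c)

/-- Unitary diagonalization, with the rank read off from the eigenvalues. -/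
theorem exists_diagonalization [Fintype σ] [DecidableEq σ] {M : Matrix σ σ ℂ}
    (hM : M.IsHermitian) :
    ∃ (U : Matrix σ σ ℂ) (e : σ → ℝ), Uᴴ * U = 1 ∧ U * Uᴴ = 1 ∧
      M = U * diagonal (fun s => (e s : ℂ)) * Uᴴ ∧ M.rank = Fintype.card {s // e s ≠ 0} ∧
      (M.PosSemidef → ∀ s, 0 ≤ e s) ∧ (M.PosDef → ∀ s, 0 < e s) := by
  refine ⟨hM.eigenvectorUnitary, hM.eigenvalues, ?_, ?_, ?_, hM.rank_eq_card_non_zero_eigs,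
    fun h => h.eigenvalues_nonneg, fun h => h.eigenvalues_pos⟩
  · simpa [star_eq_conjTranspose] using Unitary.coe_star_mul_self hM.eigenvectorUnitary
  · simpa [star_eq_conjTranspose] using Unitary.coe_mul_star_self hM.eigenvectorUnitary
  · conv_lhs => rw [hM.spectral_theorem, Unitary.conjStarAlgAut_apply]
    rfl

/-! ### Sums of simple fractions in factored form -/

/-- The function `Wᴴ (z + diag ℓ)⁻¹ W = ∑ s, w_sᴴ w_s / (z + ℓ s)`, where `w_s` is the row `s`
of `W`. The points `ℓ s` may coincide. -/
noncomputable def stieltjesSum [Fintype σ] [DecidableEq σ] {n : ℕ} (ℓ : σ → ℝ)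
    (W : Matrix σ (Fin n) ℂ) : RatMat n :=
  lift Wᴴ * diagonal (fun s => (RatFunc.X + RatFunc.C (ℓ s : ℂ))⁻¹) * lift W

/-- A non-negative matrix of rank `r` is `Wᴴ W` for a matrix `W` with `r` rows. -/
theorem exists_factor {n : ℕ} {M : Matrix (Fin n) (Fin n) ℂ} (hM : M.PosSemidef) :
    ∃ W : Matrix (Fin M.rank) (Fin n) ℂ, M = Wᴴ * W := by
  obtain ⟨U, e, -, -, hUe, hr, he, -⟩ := exists_diagonalization hM.isHermitian
  have he := he hM
  rw [← Fintype.card_fin M.rank] at hr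
  let φ := Fintype.equivOfCardEq hr
  refine ⟨Matrix.of fun s k => (Real.sqrt (e (φ s)) : ℂ) * star (U k (φ s)), ?_⟩
  ext i k
  have h1 : M i k = ∑ s, U i s * e s * star (U k s) := by
    rw [congr_fun (congr_fun hUe i) k, Matrix.mul_apply]
    simp [Matrix.mul_diagonal]
  have h2 : ∑ s ∈ Finset.univ.filter (fun s => e s ≠ 0), U i s * e s * star (U k s) =
      ∑ s, U i s * e s * star (U k s) := by
    refine Finset.sum_filter_of_ne fun s _ hs h => hs ?_
    simp [h]
  rw [h1, ← h2, Finset.sum_subtype (p := fun s => e s ≠ 0) _ (by simp), ← φ.sum_comp,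
    Matrix.mul_apply]
  refine Finset.sum_congr rfl fun s _ => ?_
  have h3 : (Real.sqrt (e (φ s)) : ℂ) * Real.sqrt (e (φ s)) = e (φ s) := by
    exact_mod_cast Real.mul_self_sqrt (he _)
  simp only [Matrix.conjTranspose_apply, Matrix.of_apply, star_mul', ← h3,
    Complex.star_def, Complex.conj_ofReal, Complex.conj_conj]
  ring

/-- A sum of simple fractions with non-negative weights in factored form; the number of rows is
the sum of the ranks of the weights. -/
theorem exists_eq_stieltjesSum {n d : ℕ} (lam : Fin d → ℝ)
    {C : Fin d → Matrix (Fin n) (Fin n) ℂ} (hC : ∀ j, (C j).PosSemidef) :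
    ∃ W : Matrix (Σ j, Fin (C j).rank) (Fin n) ℂ,
      ∑ j, (RatFunc.X + RatFunc.C (lam j : ℂ))⁻¹ • const (C j) =
        stieltjesSum (fun s => lam s.1) W := by
  choose W hW using fun j => exists_factor (hC j)
  refine ⟨Matrix.of fun s k => W s.1 s.2 k, ?_⟩
  ext i k
  rw [stieltjesSum, Matrix.mul_apply, Fintype.sum_sigma, Matrix.sum_apply]
  refine Finset.sum_congr rfl fun j _ => ?_
  have h : const (C j) = lift (W j)ᴴ * lift (W j) := by
    rw [← lift_mul, ← hW j]
    rfl
  rw [h, Matrix.smul_apply, Matrix.mul_apply, smul_eq_mul, Finset.mul_sum]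
  refine Finset.sum_congr rfl fun s _ => ?_
  rw [Matrix.mul_diagonal]
  simp only [lift, Matrix.map_apply, Matrix.conjTranspose_apply, Matrix.of_apply]
  ring

/-- Collecting the rows that belong to the same point: a function in factored form belongs to the
class, and its degree is at most the number of rows. -/
theorem affine_sub_stieltjesSum_mem [Fintype σ] [DecidableEq σ] {n : ℕ} {ℓ : σ → ℝ}
    (hℓ : ∀ s, 0 < ℓ s) (W : Matrix σ (Fin n) ℂ) {A B : Matrix (Fin n) (Fin n) ℂ}
    (hA : A.PosSemidef) (hB : B.PosSemidef)
    (h0 : (B - Wᴴ * diagonal (fun s => (ℓ s : ℂ)⁻¹) * W).PosSemidef) :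
    affine A B - stieltjesSum ℓ W ∈ classG n ∧
      delta (affine A B - stieltjesSum ℓ W) ≤ Fintype.card σ := by
  classical
  -- The poles are the distinct values of `ℓ`, enumerated by `lam`; `I j` is the indicator of the
  -- rows that belong to `lam j`.
  let Λ := Finset.univ.image ℓ
  let lam : Fin Λ.card → ℝ := fun j => Λ.equivFin.symm j
  have hinj : Function.Injective lam := Subtype.val_injective.comp Λ.equivFin.symm.injective
  have hsurj : ∀ s, ∃ j, lam j = ℓ s := fun s =>
    ⟨Λ.equivFin ⟨ℓ s, Finset.mem_image_of_mem _ (Finset.mem_univ s)⟩, by simp [lam]⟩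
  let I : Fin Λ.card → σ → ℂ := fun j s => if ℓ s = lam j then 1 else 0
  let C : Fin Λ.card → Matrix (Fin n) (Fin n) ℂ := fun j => Wᴴ * diagonal (I j) * W
  have hI : ∀ (K : Type) [Field K] (ψ : ℂ →+* K) (g : ℝ → K),
      ∑ j, g (lam j) • diagonal (fun s => ψ (I j s)) = diagonal fun s => g (ℓ s) := by
    intro K _ ψ g
    ext s t
    rw [Matrix.sum_apply]
    by_cases hst : s = t
    · subst hst
      obtain ⟨j, hj⟩ := hsurj s
      rw [Finset.sum_eq_single j]
      · simp [I, hj]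
      · intro b _ hb
        have : ℓ s ≠ lam b := fun h => hb (hinj (h.symm.trans hj.symm))
        simp [I, this]
      · simp
    · simp [hst]
  have hrep : IsRep (affine A B - stieltjesSum ℓ W) A B lam C := by
    refine ⟨fun j => ?_, hinj, hA, hB, fun j => ?_, ?_, ?_⟩
    · obtain ⟨s, -, hs⟩ := Finset.mem_image.1 (Λ.equivFin.symm j).2
      change 0 < ((Λ.equivFin.symm j : Λ) : ℝ)
      rw [← hs]
      exact hℓ s
    · refine PosSemidef.conjTranspose_mul_mul_same (PosSemidef.diagonal fun s => ?_) W
      change 0 ≤ if ℓ s = lam j then (1 : ℂ) else 0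
      split_ifs <;> simp
    · have := hI ℂ (RingHom.id ℂ) fun x => (x : ℂ)⁻¹
      simp only [RingHom.id_apply] at this
      rw [← this, Matrix.mul_sum, Matrix.sum_mul] at h0
      simpa [C] using h0
    · congr 1
      rw [stieltjesSum, ← hI (RatFunc ℂ) RatFunc.C fun x => (RatFunc.X + RatFunc.C (x : ℂ))⁻¹,
        Matrix.mul_sum, Matrix.sum_mul]
      refine Finset.sum_congr rfl fun j _ => ?_
      rw [const_eq_lift, lift_mul, lift_mul, lift_diagonal, Matrix.mul_smul, Matrix.smul_mul]
  refine ⟨⟨_, _, _, _, _, hrep⟩, ?_⟩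
  rw [hrep.delta_eq]
  calc ∑ j, (C j).rank ≤ ∑ j, (Finset.univ.filter fun s => ℓ s = lam j).card := by
        refine Finset.sum_le_sum fun j _ => ?_
        refine (rank_mul_le_left _ _).trans ((rank_mul_le_right _ _).trans ?_)
        rw [rank_diagonal, Fintype.card_subtype]
        refine Finset.card_le_card fun s => ?_
        simp [I]
    _ = Fintype.card σ := by
        rw [← Finset.card_univ, Finset.card_eq_sum_card_fiberwise (f := ℓ) (t := Λ)
          fun s _ => Finset.mem_image_of_mem _ (Finset.mem_univ s)]
        rw [← Finset.sum_coe_sort Λ]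
        exact Λ.equivFin.symm.sum_comp fun a : Λ => (Finset.univ.filter fun s => ℓ s = a).card

/-! ### Inversion through a Schur complement -/

/-- The upper left block of the inverse of a block matrix inverts the Schur complement. -/
theorem schurComplement_mul_toBlocks₁₁ {K : Type*} [CommRing K] [Fintype α] [Fintype β]
    [DecidableEq α] [DecidableEq β] {a : Matrix α α K} {b : Matrix α β K} {c : Matrix β α K}
    {d d' : Matrix β β K} {x : Matrix (α ⊕ β) (α ⊕ β) K} (hx : fromBlocks a b c d * x = 1)
    (hd : d' * d = 1) : (a - b * d' * c) * x.toBlocks₁₁ = 1 := by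
  rw [← fromBlocks_toBlocks x, fromBlocks_multiply, ← fromBlocks_one, fromBlocks_inj] at hx
  obtain ⟨h1, -, h2, -⟩ := hx
  have h3 : d' * (c * x.toBlocks₁₁) = -x.toBlocks₂₁ := by
    rw [eq_neg_of_add_eq_zero_left h2, Matrix.mul_neg, ← Matrix.mul_assoc, hd, Matrix.one_mul]
  rw [Matrix.sub_mul, Matrix.mul_assoc, Matrix.mul_assoc, h3, Matrix.mul_neg, sub_neg_eq_add, h1]

/-- The resolvent of a unitarily diagonalized matrix. -/
theorem pencil_mul_resolvent [Fintype σ] [DecidableEq σ] [Fintype τ] [DecidableEq τ]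
    {R : Matrix τ σ ℂ} (h1 : R * Rᴴ = 1) (h2 : Rᴴ * R = 1) (ℓ : σ → ℝ) :
    ((RatFunc.X : RatFunc ℂ) • 1 + lift (R * diagonal (fun s => (ℓ s : ℂ)) * Rᴴ)) *
      (lift R * diagonal (fun s => (RatFunc.X + RatFunc.C (ℓ s : ℂ))⁻¹) * lift Rᴴ) = 1 := by
  have h1' : lift R * lift Rᴴ = 1 := by rw [← lift_mul, h1, lift_one]
  have h2' : lift Rᴴ * lift R = 1 := by rw [← lift_mul, h2, lift_one]
  have hD : diagonal (fun s => RatFunc.X + RatFunc.C (ℓ s : ℂ)) =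
      (RatFunc.X : RatFunc ℂ) • 1 + lift (diagonal fun s => (ℓ s : ℂ)) := by
    rw [lift_diagonal, ← diagonal_one, ← diagonal_smul, diagonal_add]
    simp
  have hp : (RatFunc.X : RatFunc ℂ) • 1 + lift (R * diagonal (fun s => (ℓ s : ℂ)) * Rᴴ) =
      lift R * diagonal (fun s => RatFunc.X + RatFunc.C (ℓ s : ℂ)) * lift Rᴴ := by
    rw [hD, Matrix.mul_add, Matrix.add_mul, Matrix.mul_smul, Matrix.smul_mul, Matrix.mul_one, h1',
      lift_mul, lift_mul]
  have hinv : diagonal (fun s => RatFunc.X + RatFunc.C (ℓ s : ℂ)) *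
      diagonal (fun s => (RatFunc.X + RatFunc.C (ℓ s : ℂ))⁻¹) = 1 := by
    rw [diagonal_mul_diagonal, ← diagonal_one]
    congr 1
    ext1 s
    exact mul_inv_cancel₀ (X_add_C_ne_zero _)
  calc _ = lift R * (diagonal (fun s => RatFunc.X + RatFunc.C (ℓ s : ℂ)) * (lift Rᴴ * lift R) *
        diagonal (fun s => (RatFunc.X + RatFunc.C (ℓ s : ℂ))⁻¹)) * lift Rᴴ := by
        rw [hp]
        simp only [Matrix.mul_assoc]
    _ = 1 := by rw [h2', Matrix.mul_one, hinv, Matrix.mul_one, h1']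

/-- An orthonormal basis of `ℂ^σ` adapted to the range of `W` and its orthogonal complement, made
of eigenvectors of `W Wᴴ`. In this basis `W` consists of a block `V` with linearly independent
rows above a zero block; `V` has a right inverse `Y` for which `Y V` is self-adjoint. -/
theorem exists_adapted_basis [Fintype σ] [DecidableEq σ] {n : ℕ} (W : Matrix σ (Fin n) ℂ) :
    ∃ (p : σ → Prop) (_ : DecidablePred p)
      (R : Matrix ({s // p s} ⊕ {s // ¬p s}) σ ℂ) (V : Matrix {s // p s} (Fin n) ℂ)
      (Y : Matrix (Fin n) {s // p s} ℂ),
      R * Rᴴ = 1 ∧ Rᴴ * R = 1 ∧ R * W = fromRows V 0 ∧ V * Y = 1 ∧ Y * V = Vᴴ * Yᴴ := by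
  obtain ⟨U, e, hU1, hU2, hUe, -⟩ := exists_diagonalization (isHermitian_mul_conjTranspose_self W)
  have hZ : (Uᴴ * W) * (Uᴴ * W)ᴴ = diagonal fun s => (e s : ℂ) := by
    calc _ = Uᴴ * (W * Wᴴ) * U := by
          rw [conjTranspose_mul, conjTranspose_conjTranspose]
          simp only [Matrix.mul_assoc]
      _ = (Uᴴ * U) * diagonal (fun s => (e s : ℂ)) * (Uᴴ * U) := by
          rw [hUe]
          simp only [Matrix.mul_assoc]
      _ = _ := by rw [hU1, Matrix.one_mul, Matrix.mul_one]
  set Z := Uᴴ * W with hZdef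
  -- The squared norm of row `s` of `Z` is `e s`.
  have hzero : ∀ s, e s = 0 → Z s = 0 := by
    intro s hs
    have h := congr_fun (congr_fun hZ s) s
    rw [diagonal_apply_eq, hs, Complex.ofReal_zero] at h
    exact dotProduct_self_star_eq_zero.1 h
  let φ := Equiv.sumCompl fun s => e s ≠ 0
  let V : Matrix {s // e s ≠ 0} (Fin n) ℂ := Z.submatrix Subtype.val id
  have hV : V * Vᴴ = diagonal fun s : {s // e s ≠ 0} => (e s : ℂ) := by
    rw [conjTranspose_submatrix, ← submatrix_mul _ _ _ id _ Function.bijective_id, hZ,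
      submatrix_diagonal _ _ Subtype.val_injective]
    rfl
  have hinv : (diagonal fun s : {s // e s ≠ 0} => (e s : ℂ)) *
      diagonal (fun s : {s // e s ≠ 0} => (e s : ℂ)⁻¹) = 1 := by
    rw [diagonal_mul_diagonal, ← diagonal_one]
    congr 1
    ext1 s
    exact mul_inv_cancel₀ (Complex.ofReal_ne_zero.2 s.2)
  refine ⟨fun s => e s ≠ 0, inferInstance, Uᴴ.submatrix φ id, V,
    Vᴴ * diagonal (fun s : {s // e s ≠ 0} => (e s : ℂ)⁻¹), ?_, ?_, ?_, ?_, ?_⟩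
  · rw [conjTranspose_submatrix, ← submatrix_mul _ _ _ id _ Function.bijective_id,
      conjTranspose_conjTranspose, hU1, submatrix_one _ φ.injective]
  · rw [conjTranspose_submatrix, ← submatrix_mul _ _ _ φ _ φ.bijective,
      conjTranspose_conjTranspose, hU2, submatrix_one _ Function.injective_id]
  · have : Uᴴ.submatrix φ id * W = Z.submatrix φ id := by
      rw [hZdef, submatrix_mul _ _ _ id _ Function.bijective_id, submatrix_id_id]
    rw [this]
    ext (s | s) k
    · rfl
    · exact congr_fun (hzero s (not_not.1 s.2)) k
  · rw [← Matrix.mul_assoc, hV, hinv]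
  · rw [conjTranspose_mul, conjTranspose_conjTranspose, diagonal_conjTranspose, Matrix.mul_assoc]
    congr 3
    ext s
    simp

/-- The partial inverse of `Wᴴ (z + diag ℓ)⁻¹ W` is an affine function minus a function of the
same form, on a space whose dimension is smaller by the rank of `W`. -/
theorem exists_partialInverse_stieltjesSum [Fintype σ] [DecidableEq σ] {n : ℕ} {ℓ : σ → ℝ}
    (hℓ : ∀ s, 0 < ℓ s) (W : Matrix σ (Fin n) ℂ) :
    ∃ G ∈ classG n, IsPartialInverse (stieltjesSum ℓ W) G ∧
      (W ≠ 0 → delta G < Fintype.card σ) := by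
  obtain ⟨p, _, R, V, Y, hR1, hR2, hRW, hVY, hYV⟩ := exists_adapted_basis W
  set V₀ : Matrix ({s // p s} ⊕ {s // ¬p s}) (Fin n) ℂ := fromRows V 0
  have hL : (R * diagonal (fun s => (ℓ s : ℂ)) * Rᴴ).PosDef := by
    refine (PosDef.diagonal fun s => ?_).mul_mul_conjTranspose_same ?_
    · simpa using hℓ s
    · intro v w h
      simpa [vecMul_vecMul, hR1] using congr_arg (fun u => u ᵥ* Rᴴ) h
  have hx := pencil_mul_resolvent hR1 hR2 ℓ
  set x := lift R * diagonal (fun s => (RatFunc.X + RatFunc.C (ℓ s : ℂ))⁻¹) * lift Rᴴ with hxdef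
  set L := R * diagonal (fun s => (ℓ s : ℂ)) * Rᴴ with hLdef
  have hL21 : L.toBlocks₂₁ = L.toBlocks₁₂ᴴ := by
    ext i j
    exact (hL.isHermitian.apply _ _).symm
  have hL22 : L.toBlocks₂₂.PosDef := hL.submatrix Sum.inr_injective
  obtain ⟨U, μ, hU1, hU2, hUμ, -, -, hμ⟩ := exists_diagonalization hL22.isHermitian
  have hμ := hμ hL22
  have hres := pencil_mul_resolvent hU2 hU1 μ
  rw [← hUμ] at hres
  set d' := lift U * diagonal (fun s => (RatFunc.X + RatFunc.C (μ s : ℂ))⁻¹) * lift Uᴴ with hd'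
  have hblocks : (RatFunc.X : RatFunc ℂ) • 1 + lift L = fromBlocks
      ((RatFunc.X : RatFunc ℂ) • 1 + lift L.toBlocks₁₁) (lift L.toBlocks₁₂) (lift L.toBlocks₂₁)
      ((RatFunc.X : RatFunc ℂ) • 1 + lift L.toBlocks₂₂) := by
    ext (i | i) (j | j) <;> simp [lift, toBlocks₁₁, toBlocks₁₂, toBlocks₂₁, toBlocks₂₂, one_apply]
  rw [hblocks] at hx
  have hT := schurComplement_mul_toBlocks₁₁ hx (mul_eq_one_comm.1 hres)
  set T := (RatFunc.X : RatFunc ℂ) • 1 + lift L.toBlocks₁₁ -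
    lift L.toBlocks₁₂ * d' * lift L.toBlocks₂₁ with hTdef
  have hT' := mul_eq_one_comm.1 hT
  -- In the adapted basis only the upper left block of the resolvent meets `W`.
  have hS : stieltjesSum ℓ W = lift Vᴴ * x.toBlocks₁₁ * lift V := by
    have hW : W = Rᴴ * V₀ := by rw [← hRW, ← Matrix.mul_assoc, hR2, Matrix.one_mul]
    have h1 : lift V₀ =
        fromRows (lift V) 0 := by
      ext (i | i) j <;> simp [lift, V₀]
    have h2 : lift V₀ᴴ =
        fromCols (lift Vᴴ) 0 := by
      ext i (j | j) <;> simp [lift, V₀]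
    calc stieltjesSum ℓ W = lift V₀ᴴ * x * lift V₀ := by
          rw [stieltjesSum, hW, conjTranspose_mul, conjTranspose_conjTranspose, lift_mul, lift_mul,
            hxdef]
          simp only [Matrix.mul_assoc]
      _ = _ := by
          rw [h1, h2, ← fromBlocks_toBlocks x, fromCols_mul_fromBlocks, fromCols_mul_fromRows]
          simp
  have hVY' : lift V * lift Y = 1 := by rw [← lift_mul, hVY, lift_one]
  have hYV' : lift Yᴴ * lift Vᴴ = 1 := by
    rw [← lift_mul, ← conjTranspose_mul, hVY, conjTranspose_one, lift_one]
  have hP1 : const (Y * V) = lift Y * lift V := lift_mul _ _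
  have hP2 : const (Y * V) = lift Vᴴ * lift Yᴴ := by rw [hYV]; exact lift_mul _ _
  have hinv : IsPartialInverse (stieltjesSum ℓ W) (lift Y * T * lift Yᴴ) := by
    refine ⟨Y * V, ⟨?_, ?_⟩, ?_, ?_, ?_, ?_, ?_, ?_⟩
    · calc Y * V * (Y * V) = Y * (V * Y) * V := by simp only [Matrix.mul_assoc]
        _ = _ := by rw [hVY, Matrix.mul_one]
    · rw [isSelfAdjoint_iff, star_eq_conjTranspose, conjTranspose_mul, hYV]
    · rw [hS, hP2]
      calc _ = lift Vᴴ * (lift Yᴴ * lift Vᴴ) * x.toBlocks₁₁ * lift V := by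
            simp only [Matrix.mul_assoc]
        _ = _ := by rw [hYV', Matrix.mul_one]
    · rw [hS, hP1]
      calc _ = lift Vᴴ * x.toBlocks₁₁ * (lift V * lift Y) * lift V := by
            simp only [Matrix.mul_assoc]
        _ = _ := by rw [hVY', Matrix.mul_one]
    · rw [hP1]
      calc _ = lift Y * (lift V * lift Y) * T * lift Yᴴ := by simp only [Matrix.mul_assoc]
        _ = _ := by rw [hVY', Matrix.mul_one]
    · rw [hP2]
      calc _ = lift Y * T * (lift Yᴴ * lift Vᴴ) * lift Yᴴ := by simp only [Matrix.mul_assoc]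
        _ = _ := by rw [hYV', Matrix.mul_one]
    · rw [hS, hP2]
      calc _ = lift Vᴴ * (x.toBlocks₁₁ * ((lift V * lift Y) * T)) * lift Yᴴ := by
            simp only [Matrix.mul_assoc]
        _ = _ := by rw [hVY', Matrix.one_mul, hT', Matrix.mul_one]
    · rw [hS, hP1]
      calc _ = lift Y * (T * ((lift Yᴴ * lift Vᴴ) * x.toBlocks₁₁)) * lift V := by
            simp only [Matrix.mul_assoc]
        _ = _ := by rw [hYV', Matrix.one_mul, hT, Matrix.mul_one]
  -- A second change of basis diagonalizes the lower right block and exhibits the poles `-μ s`.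
  have hG : lift Y * T * lift Yᴴ = affine (Y * Yᴴ) (Y * L.toBlocks₁₁ * Yᴴ) -
      stieltjesSum μ (Uᴴ * L.toBlocks₂₁ * Yᴴ) := by
    rw [hTdef, affine, stieltjesSum, hd', const_eq_lift, const_eq_lift, hL21]
    simp only [conjTranspose_mul, conjTranspose_conjTranspose, lift_mul, Matrix.mul_sub,
      Matrix.sub_mul, Matrix.mul_add, Matrix.add_mul, Matrix.mul_smul, Matrix.smul_mul,
      Matrix.mul_one, Matrix.mul_assoc]
  have hμ' : L.toBlocks₂₂⁻¹ = U * diagonal (fun s => (μ s : ℂ)⁻¹) * Uᴴ := by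
    refine inv_eq_right_inv ?_
    rw [hUμ]
    calc _ = U * (diagonal (fun s => (μ s : ℂ)) * ((Uᴴ * U) * diagonal (fun s => (μ s : ℂ)⁻¹))) *
          Uᴴ := by simp only [Matrix.mul_assoc]
      _ = U * diagonal (fun _ => (1 : ℂ)) * Uᴴ := by
          rw [hU1, Matrix.one_mul, diagonal_mul_diagonal]
          congr 3
          ext1 s
          exact mul_inv_cancel₀ (Complex.ofReal_ne_zero.2 (hμ s).ne')
      _ = 1 := by rw [diagonal_one, Matrix.mul_one, hU2]
  -- The value at `0` is the Schur complement of the positive definite matrix `L`.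
  have hschur : (L.toBlocks₁₁ - L.toBlocks₁₂ * L.toBlocks₂₂⁻¹ * L.toBlocks₁₂ᴴ).PosSemidef := by
    have := hL22.isUnit.invertible
    rw [← PosDef.fromBlocks₂₂ _ _ hL22, ← hL21, fromBlocks_toBlocks]
    exact hL.posSemidef
  have hmem := affine_sub_stieltjesSum_mem hμ (Uᴴ * L.toBlocks₂₁ * Yᴴ)
    (posSemidef_self_mul_conjTranspose Y)
    ((hL.posSemidef.submatrix Sum.inl).mul_mul_conjTranspose_same Y) (by
      convert! hschur.mul_mul_conjTranspose_same Y using 1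
      rw [hμ', hL21]
      simp only [conjTranspose_mul, conjTranspose_conjTranspose, Matrix.mul_sub, Matrix.sub_mul,
        Matrix.mul_assoc]
      rfl)
  change affine (Y * Yᴴ) (Y * L.toBlocks₁₁ * Yᴴ) - _ ∈ _ ∧
    delta (affine (Y * Yᴴ) (Y * L.toBlocks₁₁ * Yᴴ) - _) ≤ _ at hmem
  rw [← hG] at hmem
  refine ⟨_, hmem.1, hinv, fun hW => ?_⟩
  refine hmem.2.trans_lt ?_
  by_contra hcard
  -- If no basis vector lies in the range of `W`, then `W` vanishes.
  have hp : IsEmpty {s // p s} := by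
    have := Fintype.card_subtype_compl p
    have h2 := Fintype.card_subtype_le p
    rw [← Fintype.card_eq_zero_iff]
    omega
  apply hW
  calc W = Rᴴ * (R * W) := by rw [← Matrix.mul_assoc, hR2, Matrix.one_mul]
    _ = 0 := by
      rw [hRW]
      have : V₀ = 0 := by
        ext (i | i) j
        · exact hp.elim i
        · rfl
      rw [this, Matrix.mul_zero]

/-! ### Partial inverses -/

/-- The partial inverse is unique, and so is its projection. -/
theorem IsPartialInverse.unique {n : ℕ} {R G G' : RatMat n} (h : IsPartialInverse R G)
    (h' : IsPartialInverse R G') : G = G' := by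
  obtain ⟨P, hP, hPR, hRP, hPG, hGP, hRG, hGR⟩ := h
  obtain ⟨P', hP', hPR', hRP', hPG', hGP', hRG', hGR'⟩ := h'
  -- Both projections have the range of `R` as their range.
  have e1 : P' * P = P := lift_injective (by
    rw [lift_mul, ← const_eq_lift, ← const_eq_lift, ← hRG, ← mul_assoc, hPR'])
  have e2 : P * P' = P' := lift_injective (by
    rw [lift_mul, ← const_eq_lift, ← const_eq_lift, ← hRG', ← mul_assoc, hPR])
  have e : P' = P := by
    have := congr_arg star e1
    rw [star_mul, hP.isSelfAdjoint.star_eq, hP'.isSelfAdjoint.star_eq, e2] at this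
    exact this
  subst e
  calc G = G * (R * G') := by rw [hRG', hGP]
    _ = G' := by rw [← mul_assoc, hGR, hPG']

theorem IsPartialInverse.symm {n : ℕ} {R G : RatMat n} (h : IsPartialInverse R G) :
    IsPartialInverse G R := by
  obtain ⟨P, hP, hPR, hRP, hPG, hGP, hRG, hGR⟩ := h
  exact ⟨P, hP, hPG, hGP, hPR, hRP, hGR, hRG⟩

theorem IsPartialInverse.neg {n : ℕ} {R G : RatMat n} (h : IsPartialInverse R G) :
    IsPartialInverse (-R) (-G) := by
  obtain ⟨P, hP, hPR, hRP, hPG, hGP, hRG, hGR⟩ := h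
  exact ⟨P, hP, by rw [mul_neg, hPR], by rw [neg_mul, hRP], by rw [mul_neg, hPG],
    by rw [neg_mul, hGP], by rw [neg_mul_neg, hRG], by rw [neg_mul_neg, hGR]⟩

theorem isPartialInverse_zero (n : ℕ) : IsPartialInverse (0 : RatMat n) 0 := by
  refine ⟨0, .zero _, ?_⟩
  simp [const_eq_lift, lift_zero]

/-! ### Taylor expansion at the origin -/

theorem IsRep.value_zero {n d : ℕ} {f : RatMat n} {A B : Matrix (Fin n) (Fin n) ℂ}
    {lam : Fin d → ℝ} {C : Fin d → Matrix (Fin n) (Fin n) ℂ} (h : IsRep f A B lam C) :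
    value f 0 = B - ∑ j, ((lam j : ℂ)⁻¹) • C j := by
  ext i k
  rw [h.eval_eq 0 fun j => by simpa using (h.lam_pos j).ne']
  simp [Matrix.sum_apply]

theorem IsRep.derivValue_zero {n d : ℕ} {f : RatMat n} {A B : Matrix (Fin n) (Fin n) ℂ}
    {lam : Fin d → ℝ} {C : Fin d → Matrix (Fin n) (Fin n) ℂ} (h : IsRep f A B lam C) :
    derivValue f 0 = A + ∑ j, ((lam j : ℂ)⁻¹ ^ 2) • C j := by
  ext i k
  have hne : ∀ j, (0 : ℂ) + lam j ≠ 0 := fun j => by simpa using (h.lam_pos j).ne'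
  have hev : (fun w : ℂ => (f i k).eval (RingHom.id ℂ) w) =ᶠ[𝓝 0]
      fun z => z * A i k + B i k - ∑ j, (z + lam j)⁻¹ * C j i k := by
    have : ∀ᶠ z : ℂ in 𝓝 0, ∀ j, z + lam j ≠ 0 := by
      rw [eventually_all]
      intro j
      have hc : ContinuousAt (fun z : ℂ => z + lam j) 0 := by fun_prop
      exact hc.eventually_ne (hne j)
    filter_upwards [this] with z hz
    exact h.eval_eq z hz i k
  have hd : HasDerivAt (fun z : ℂ => z * A i k + B i k - ∑ j, (z + lam j)⁻¹ * C j i k)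
      (1 * A i k - ∑ j, (-1 / (0 + (lam j : ℂ)) ^ 2) * C j i k) 0 := by
    refine (((hasDerivAt_id _).mul_const _).add_const _).sub (HasDerivAt.fun_sum fun j _ => ?_)
    exact (((hasDerivAt_id (0 : ℂ)).add_const (lam j : ℂ)).fun_inv (hne j)).mul_const _
  change deriv (fun w : ℂ => (f i k).eval (RingHom.id ℂ) w) 0 = _
  rw [hev.deriv_eq, hd.deriv]
  simp [Matrix.sum_apply, neg_div]

/-- The second quotient is a sum of simple fractions at the same poles, because
`1 / (z + a) = 1 / a - z / a² + z² / (a² (z + a))`. -/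
theorem IsRep.secondQuotient_eq {n d : ℕ} {f : RatMat n} {A B : Matrix (Fin n) (Fin n) ℂ}
    {lam : Fin d → ℝ} {C : Fin d → Matrix (Fin n) (Fin n) ℂ} (h : IsRep f A B lam C) :
    secondQuotient f =
      -∑ j, (RatFunc.X + RatFunc.C (lam j : ℂ))⁻¹ • const (((lam j : ℂ)⁻¹ ^ 2) • C j) := by
  have hX : (RatFunc.X : RatFunc ℂ) ≠ 0 := RatFunc.X_ne_zero
  have key : ∀ (j : Fin d) (c : ℂ), (RatFunc.X + RatFunc.C (lam j : ℂ))⁻¹ * RatFunc.C c -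
      RatFunc.C ((lam j : ℂ)⁻¹ * c) + RatFunc.X * RatFunc.C ((lam j : ℂ)⁻¹ ^ 2 * c) =
      RatFunc.X ^ 2 * ((RatFunc.X + RatFunc.C (lam j : ℂ))⁻¹ *
        RatFunc.C ((lam j : ℂ)⁻¹ ^ 2 * c)) := by
    intro j c
    have h1 := X_add_C_ne_zero (lam j : ℂ)
    have h2 : RatFunc.C (lam j : ℂ) ≠ 0 := by
      simpa using (h.lam_pos j).ne'
    simp only [map_mul, map_pow, map_inv₀]
    field_simp
    ring
  rw [secondQuotient, h.value_zero, h.derivValue_zero, inv_smul_eq_iff₀ (pow_ne_zero 2 hX)]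
  ext i k
  have e : f i k = RatFunc.X * RatFunc.C (A i k) + RatFunc.C (B i k) -
      ∑ j, (RatFunc.X + RatFunc.C (lam j : ℂ))⁻¹ * RatFunc.C (C j i k) := by
    rw [h.eq]
    simp [affine, const, Matrix.sum_apply]
  have e2 : ((RatFunc.X : RatFunc ℂ) ^ 2 • -∑ j, (RatFunc.X + RatFunc.C (lam j : ℂ))⁻¹ •
      const (((lam j : ℂ)⁻¹ ^ 2) • C j)) i k = -∑ j, RatFunc.X ^ 2 *
        ((RatFunc.X + RatFunc.C (lam j : ℂ))⁻¹ * RatFunc.C ((lam j : ℂ)⁻¹ ^ 2 * C j i k)) := by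
    simp only [Matrix.smul_apply, Matrix.neg_apply, Matrix.sum_apply, const, Matrix.map_apply,
      smul_eq_mul, mul_neg, Finset.mul_sum]
  rw [e2]
  simp only [← key, Finset.sum_add_distrib, Finset.sum_sub_distrib]
  simp only [Matrix.sub_apply, Matrix.smul_apply, const, Matrix.map_apply, Matrix.add_apply,
    Matrix.sum_apply, e, smul_eq_mul, map_sub, map_add, map_sum, mul_add, Finset.mul_sum]
  ring

/-- The definition of the second quotient, solved for `f`. -/
theorem eq_affine_add_secondQuotient {n : ℕ} (f : RatMat n) :
    f = affine (derivValue f 0) (value f 0) + (RatFunc.X : RatFunc ℂ) ^ 2 • secondQuotient f := by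
  rw [secondQuotient, smul_inv_smul₀ (pow_ne_zero 2 RatFunc.X_ne_zero), affine]
  abel

theorem value_posSemidef {n : ℕ} {f : RatMat n} (hf : f ∈ classG n) :
    (value f 0).PosSemidef := by
  obtain ⟨d, A, B, lam, C, h⟩ := hf
  rw [h.value_zero]
  exact h.zero_nonneg

theorem smul_inv_sq_posSemidef {n : ℕ} {M : Matrix (Fin n) (Fin n) ℂ} (hM : M.PosSemidef)
    (a : ℝ) : (((a : ℂ)⁻¹ ^ 2) • M).PosSemidef := by
  refine hM.smul ?_
  have : ((a : ℂ)⁻¹ ^ 2) = ((a⁻¹ ^ 2 : ℝ) : ℂ) := by push_cast; rfl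
  rw [this]
  exact Complex.zero_le_real.2 (sq_nonneg _)

theorem derivValue_posSemidef {n : ℕ} {f : RatMat n} (hf : f ∈ classG n) :
    (derivValue f 0).PosSemidef := by
  obtain ⟨d, A, B, lam, C, h⟩ := hf
  rw [h.derivValue_zero]
  exact h.A_nonneg.add (posSemidef_sum _ fun j _ => smul_inv_sq_posSemidef (h.C_nonneg j) _)

/-- Such an `f` is affine, hence has a representation without poles. -/
theorem delta_eq_zero_of_secondQuotient_eq_zero {n : ℕ} {f : RatMat n} (hf : f ∈ classG n)
    (h : secondQuotient f = 0) : delta f = 0 := by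
  have hrep : IsRep f (derivValue f 0) (value f 0) (Fin.elim0 : Fin 0 → ℝ) Fin.elim0 := by
    refine ⟨fun j => j.elim0, fun j => j.elim0, derivValue_posSemidef hf, value_posSemidef hf,
      fun j => j.elim0, by simpa using value_posSemidef hf, ?_⟩
    simpa [h] using eq_affine_add_secondQuotient f
  simpa using hrep.delta_eq

theorem secondQuotient_eq_zero {n : ℕ} {f : RatMat n} (hf : f ∈ classG n) (h : delta f = 0) :
    secondQuotient f = 0 := by
  obtain ⟨d, A, B, lam, C, hrep⟩ := hf
  rw [hrep.delta_eq, Finset.sum_eq_zero_iff] at h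
  rw [hrep.secondQuotient_eq, neg_eq_zero]
  refine Finset.sum_eq_zero fun j hj => ?_
  have hC : C j = 0 := by
    have : (C j).mulVecLin = 0 := by
      rw [← LinearMap.range_eq_bot, ← Submodule.finrank_eq_zero]
      exact h j hj
    rw [← mulVecLin_zero] at this
    exact mulVec_injective (congr_arg DFunLike.coe this)
  rw [hC, smul_zero, const_eq_lift, lift_zero, smul_zero]

/-! ### The reduction step -/

theorem IsReduction.unique {n : ℕ} {f g g' : RatMat n} (h : IsReduction f g)
    (h' : IsReduction f g') : g = g' := by
  obtain ⟨G, hG, rfl⟩ := h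
  obtain ⟨G', hG', rfl⟩ := h'
  rw [hG.unique hG']

/-- The reduction step stays in the class and lowers a positive degree. -/
theorem exists_isReduction {n : ℕ} {f : RatMat n} (hf : f ∈ classG n) :
    ∃ g ∈ classG n, IsReduction f g ∧ (0 < delta f → delta g < delta f) ∧
      (delta f = 0 → g = 0) := by
  have hf' := hf
  obtain ⟨d, A, B, lam, C, h⟩ := hf'
  have hpos := fun j => smul_inv_sq_posSemidef (h.C_nonneg j) (lam j)
  obtain ⟨W, hW⟩ := exists_eq_stieltjesSum lam hpos
  have hsq : secondQuotient f = -stieltjesSum (fun s => lam s.1) W := by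
    rw [h.secondQuotient_eq, hW]
  have hcard : Fintype.card (Σ j, Fin (((lam j : ℂ)⁻¹ ^ 2) • C j).rank) ≤ delta f := by
    -- Scaling a weight does not increase its rank.
    rw [h.delta_eq, Fintype.card_sigma]
    refine Finset.sum_le_sum fun j _ => ?_
    rw [Fintype.card_fin, smul_eq_diagonal_mul]
    exact rank_mul_le_right _ _
  obtain ⟨G, hG, hinv, hlt⟩ :=
    exists_partialInverse_stieltjesSum (fun s => h.lam_pos s.1) W
  have hred : IsReduction f G := ⟨-G, hsq ▸ hinv.neg, (neg_neg G).symm⟩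
  refine ⟨G, hG, hred, fun hδ => (hlt ?_).trans_le hcard, fun hδ => ?_⟩
  · rintro rfl
    refine hδ.ne' (delta_eq_zero_of_secondQuotient_eq_zero hf ?_)
    rw [hsq, stieltjesSum, lift_zero, Matrix.mul_zero, neg_zero]
  · have h0 := secondQuotient_eq_zero hf hδ
    refine hred.unique ⟨0, ?_, neg_zero.symm⟩
    rw [h0]
    exact isPartialInverse_zero n

/-! ### Reflection -/

/-- Substitution of `1 / z` meets no pole, since `1 / z` is transcendental over `ℂ`. -/
theorem eval₂_inv_X_ne_zero {p : Polynomial ℂ} (hp : p ≠ 0) :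
    p.eval₂ RatFunc.C (RatFunc.X : RatFunc ℂ)⁻¹ ≠ 0 := fun h =>
  RatFunc.transcendental_X (IsAlgebraic.inv_iff.1 ⟨p, hp, h⟩)

/-- The substitution `z ↦ 1 / z` as a ring homomorphism. -/
noncomputable def invSubst : RatFunc ℂ →+* RatFunc ℂ where
  toFun r := r.eval RatFunc.C (RatFunc.X : RatFunc ℂ)⁻¹
  map_zero' := RatFunc.eval_zero _ _
  map_one' := RatFunc.eval_one _ _
  map_add' r s := RatFunc.eval_add _ _ (eval₂_inv_X_ne_zero r.denom_ne_zero)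
    (eval₂_inv_X_ne_zero s.denom_ne_zero)
  map_mul' r s := RatFunc.eval_mul _ _ (eval₂_inv_X_ne_zero r.denom_ne_zero)
    (eval₂_inv_X_ne_zero s.denom_ne_zero)

theorem invSubst_C (c : ℂ) : invSubst (RatFunc.C c) = RatFunc.C c := RatFunc.eval_C _ _

theorem invSubst_X : invSubst RatFunc.X = RatFunc.X⁻¹ := RatFunc.eval_X _ _

theorem reflect_eq {n : ℕ} (f : RatMat n) :
    reflect f = (RatFunc.X : RatFunc ℂ) • f.map invSubst := rfl

theorem map_invSubst_const {n : ℕ} (M : Matrix (Fin n) (Fin n) ℂ) :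
    (const M).map invSubst = const M := by
  ext i k
  exact invSubst_C _

theorem reflect_affine {n : ℕ} (A B : Matrix (Fin n) (Fin n) ℂ) :
    reflect (affine A B) = affine B A := by
  have hX : (RatFunc.X : RatFunc ℂ) ≠ 0 := RatFunc.X_ne_zero
  ext i k
  simp only [reflect_eq, affine, const, Matrix.smul_apply, Matrix.map_apply, Matrix.add_apply,
    smul_eq_mul, map_add, map_mul, invSubst_C, invSubst_X]
  field_simp
  ring

/-- Reflection turns the partial inverse `H` of `g` into the partial inverse of `z g(1/z)`. -/
theorem IsPartialInverse.reflect {n : ℕ} {g H : RatMat n} (h : IsPartialInverse g H) :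
    IsPartialInverse (reflect g) ((RatFunc.X : RatFunc ℂ)⁻¹ • H.map invSubst) := by
  have hX : (RatFunc.X : RatFunc ℂ) ≠ 0 := RatFunc.X_ne_zero
  obtain ⟨P, hP, h1, h2, h3, h4, h5, h6⟩ := h
  have hmap : ∀ {R S T : RatMat n}, R * S = T →
      R.map invSubst * S.map invSubst = T.map invSubst := by
    rintro R S T rfl
    exact (Matrix.map_mul ..).symm
  have h1 := hmap h1
  have h2 := hmap h2
  have h3 := hmap h3
  have h4 := hmap h4
  have h5 := hmap h5
  have h6 := hmap h6
  rw [map_invSubst_const] at h1 h2 h3 h4 h5 h6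
  refine ⟨P, hP, ?_, ?_, ?_, ?_, ?_, ?_⟩
  · rw [reflect_eq, mul_smul_comm, h1]
  · rw [reflect_eq, smul_mul_assoc, h2]
  · rw [mul_smul_comm, h3]
  · rw [smul_mul_assoc, h4]
  · rw [reflect_eq, smul_mul_smul_comm, h5, mul_inv_cancel₀ hX, one_smul]
  · rw [reflect_eq, smul_mul_smul_comm, h6, inv_mul_cancel₀ hX, one_smul]

/-! ### The continued fractions -/

/-- A chain of reductions that ends in an affine function unfolds to a continued fraction. -/
theorem isStieltjesFraction_of_chain {n : ℕ} (N : ℕ) (F : ℕ → RatMat n)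
    (hF : ∀ k < N, IsReduction (F k) (F (k + 1))) (hN : secondQuotient (F N) = 0) :
    IsStieltjesFraction N (fun k => value (F k) 0) (fun k => derivValue (F k) 0) (F 0) := by
  induction N generalizing F with
  | zero => simpa [IsStieltjesFraction, hN] using eq_affine_add_secondQuotient (F 0)
  | succ N ih =>
    obtain ⟨G, hG, hFG⟩ := hF 0 N.succ_pos
    refine ⟨F 1, -secondQuotient (F 0),
      ih (fun k => F (k + 1)) (fun k hk => hF (k + 1) (Nat.succ_lt_succ hk)) hN, ?_, ?_⟩
    · rw [hFG]
      exact hG.symm.neg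
    · rw [smul_neg, sub_neg_eq_add]
      exact eq_affine_add_secondQuotient (F 0)

/-- The reflection of `A + B z - z² H(z)` is `A z + B - H(1/z) / z`, so that the second fraction
is the reflection of the first, level by level. -/
theorem IsStieltjesFraction.reflect {n : ℕ} (N : ℕ) (A B : ℕ → Matrix (Fin n) (Fin n) ℂ)
    (f : RatMat n) (h : IsStieltjesFraction N A B f) : IsJFraction N A B (reflect f) := by
  induction N generalizing A B f with
  | zero =>
    have h : f = affine (B 0) (A 0) := h
    rw [h, reflect_affine]
    rfl
  | succ N ih =>
    obtain ⟨g, H, hg, hH, rfl⟩ := h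
    refine ⟨_, _, ih _ _ g hg, hH.reflect, ?_⟩
    have hX : (RatFunc.X : RatFunc ℂ) ≠ 0 := RatFunc.X_ne_zero
    conv_rhs => rw [← reflect_affine]
    ext i k
    simp only [reflect_eq, Matrix.sub_apply, Matrix.smul_apply, Matrix.map_apply, smul_eq_mul,
      map_sub, map_mul, map_pow, invSubst_X]
    field_simp

/-- The reduction step can be iterated until the degree is zero. -/
theorem exists_chain {n : ℕ} (f : RatMat n) (hf : f ∈ classG n) :
    ∃ (N : ℕ) (F : ℕ → RatMat n), N ≤ delta f ∧ F 0 = f ∧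
      (∀ k < N, IsReduction (F k) (F (k + 1)) ∧ delta (F (k + 1)) < delta (F k)) ∧
      delta (F N) = 0 ∧ ∀ k ≤ N, F k ∈ classG n := by
  induction hm : delta f using Nat.strong_induction_on generalizing f with
  | _ m ih =>
    subst hm
    obtain h0 | hpos := Nat.eq_zero_or_pos (delta f)
    · exact ⟨0, fun _ => f, Nat.zero_le _, rfl, by simp, h0, fun _ _ => hf⟩
    · obtain ⟨g, hg, hred, hlt, -⟩ := exists_isReduction hf
      have hlt := hlt hpos
      obtain ⟨N, F, hN, hF0, hstep, hend, hmem⟩ := ih _ hlt g hg rfl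
      refine ⟨N + 1, fun k => Nat.casesOn k f F, by omega, rfl, ?_, hend, ?_⟩
      · rintro (_ | k) hk
        · exact ⟨show IsReduction f (F 0) from hF0 ▸ hred,
            show delta (F 0) < delta f from hF0 ▸ hlt⟩
        · exact hstep k (by omega)
      · rintro (_ | k) hk
        · exact hf
        · exact hmem k (by omega)

end RationalG

theorem mainTheorem1 (n : ℕ) (f : RatMat n) (hf : f ∈ classG n) :
    -- the reduction step: `f₁` exists, is unique, and belongs to the class
    (∃! f₁ : RatMat n, IsReduction f f₁) ∧
    (∀ f₁ : RatMat n, IsReduction f f₁ →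
      f₁ ∈ classG n ∧ (0 < delta f → delta f₁ < delta f) ∧ (delta f = 0 → f₁ = 0)) ∧
    -- iterating it terminates, and yields the two forms of the continued fraction
    (∃ (N : ℕ) (F : ℕ → RatMat n), N ≤ delta f ∧ F 0 = f ∧
      (∀ k < N, IsReduction (F k) (F (k + 1)) ∧ delta (F (k + 1)) < delta (F k)) ∧
      delta (F N) = 0 ∧
      (∀ k ≤ N, F k ∈ classG n ∧
        (value (F k) 0).PosSemidef ∧ (derivValue (F k) 0).PosSemidef) ∧
      IsStieltjesFraction N (fun k => value (F k) 0) (fun k => derivValue (F k) 0) f ∧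
      IsJFraction N (fun k => value (F k) 0) (fun k => derivValue (F k) 0) (reflect f)) := by
  refine ⟨?_, ?_, ?_⟩
  · obtain ⟨g, -, hred, -⟩ := exists_isReduction hf
    exact ⟨g, hred, fun g' hg' => hg'.unique hred⟩
  · intro f₁ hf₁
    obtain ⟨g, hg, hred, h1, h2⟩ := exists_isReduction hf
    rw [hf₁.unique hred]
    exact ⟨hg, h1, h2⟩
  · obtain ⟨N, F, hN, hF0, hstep, hend, hmem⟩ := exists_chain f hf
    have hfrac := isStieltjesFraction_of_chain N F (fun k hk => (hstep k hk).1)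
      (secondQuotient_eq_zero (hmem N le_rfl) hend)
    rw [hF0] at hfrac
    exact ⟨N, F, hN, hF0, hstep, hend,
      fun k hk => ⟨hmem k hk, value_posSemidef (hmem k hk), derivValue_posSemidef (hmem k hk)⟩,
      hfrac, hfrac.reflect⟩
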